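/- Let $k\ge 1$ be an integer. A \emph{$k$-tree} is a finite graph obtained by the following recursive construction: the complete graph $K_k$ is a $k$-tree; if $T$ is a $k$-tree, then so is the graph obtained from $T$ by joining a new vertex to all vertices of some $k$-clique of $T$; there are no other $k$-trees. A \emph{sub-$k$-tree} of a $k$-tree $T$ is a subgraph of $T$ that is itself a $k$-tree. Let $S(T)$ be the set of all sub-$k$-trees of $T$ and, for a $k$-clique $C$ of $T$, let $S(T;C)$ be the set of those that contain $C$. Write $|X|$ for the number of vertices of a graph $X$, and put $$\mu(T)=\frac{1}{|S(T)|}\sum_{X\in S(T)}|X|,\qquad \mu(T;C)=\frac{1}{|S(T;C)|}\sum_{X\in S(T;C)}|X| .$$ \textbf{Theorem.} For every integer $k\ge 1$, every $k$-tree $T$ and every $k$-clique $C$ of $T$, $$\mu(T;C)<2\,\mu(T).$$ -/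

import Mathlib

universe u

/-- `IsKTree k G`: the graph `G` is a `k`-tree. A graph isomorphic to `K_k` is a `k`-tree, and so is
every graph `G` with a vertex `v` such that `G - v` is a `k`-tree and the neighbours of `v` are
exactly the vertices of some `k`-clique `C` (which lies in `G - v`, as `v` is not adjacent to
itself). -/
inductive IsKTree (k : ℕ) : {V : Type u} → SimpleGraph V → Prop
  | complete {V : Type u} {G : SimpleGraph V} (e : G ≃g (⊤ : SimpleGraph (Fin k))) : IsKTree k G
  | join {V : Type u} {G : SimpleGraph V} (v : V) (C : Finset V)
      (h : IsKTree k (G.induce {v}ᶜ)) (hC : G.IsNClique k C)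
      (hv : ∀ w, G.Adj v w ↔ w ∈ C) : IsKTree k G

namespace KTree

noncomputable section

open Classical

/-- `S(T)`: the sub-`k`-trees of `T`, i.e. the subgraphs of `T` that are themselves `k`-trees. -/
def subs (k : ℕ) {V : Type u} [Fintype V] (T : SimpleGraph V) : Finset T.Subgraph :=
  Finset.univ.filter fun X => IsKTree k X.coe

/-- `S(T; C)`: the sub-`k`-trees of `T` that contain the clique on the vertex set `C`
(as a subgraph). -/
def subsAt (k : ℕ) {V : Type u} [Fintype V] (T : SimpleGraph V) (C : Finset V) :
    Finset T.Subgraph :=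
  (subs k T).filter fun X => (⊤ : T.Subgraph).induce (C : Set V) ≤ X

/-- `μ(T) = R(T) / N(T)`: the mean number of vertices of the sub-`k`-trees of `T`. -/
def globalMean (k : ℕ) {V : Type u} [Fintype V] (T : SimpleGraph V) : ℚ :=
  ((∑ X ∈ subs k T, X.verts.ncard : ℕ) : ℚ) / ((subs k T).card : ℚ)

/-- `μ(T; C) = R(T; C) / N(T; C)`: the mean number of vertices of the sub-`k`-trees of `T` that
contain `C`. -/
def localMean (k : ℕ) {V : Type u} [Fintype V] (T : SimpleGraph V) (C : Finset V) : ℚ :=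
  ((∑ X ∈ subsAt k T C, X.verts.ncard : ℕ) : ℚ) / ((subsAt k T C).card : ℚ)

end

end KTree

/-!
Let `C` be a `k`-clique of the `k`-tree `T`. Write `n` for the number of sub-`k`-trees containing
`C`, `δ` for the average of `|X| - k` over them, `nb` for the number of all sub-`k`-trees, and `db`
for the sum of `|X| - k` over all of them. The claim says `(k + δ) * nb < 2 * (k * nb + db)`. The
stronger inequality `δ * nb ≤ k * (nb - 1) + 2 * db` is proved by induction, together with the
auxiliary bounds `2 * δ ≤ n - 1` and `nb ≤ n * (k + δ) - k + 1` (`Profile.Good`).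

Rooted `k`-trees arise from the trivial one, a single clique, by two operations: gluing two of them
along the root clique, and joining a new vertex to the root clique, with rooted `k`-trees hanging
at the `k` other cliques of the new `(k + 1)`-clique. The effect on `(n, δ, nb, db)` is explicit,
since `n` is multiplicative and `δ` is additive over independent parts, and a sub-`k`-tree that
does not contain the root clique lies in one of the hanging parts. That both operations preserve
the inequalities is `Profile.Good.merge` and `Profile.Good.extend`.

To avoid splitting graphs into parts, a `k`-tree is not decomposed but carries virtual data: at
each clique `E` hangs an imaginary rooted `k`-tree, known only through its profile `d E`, and the
sub-`k`-trees of the actual `k`-tree are counted with the corresponding weights (`total`). Removing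
the last vertex `v`, joined to a clique `D`, amounts to replacing the profile at `D` by one obtained
with the two operations from the profiles at `D` and at the `k` new cliques through `v`
(`IsJoin.total_insert`). When the vertices outside `C` have been removed, the profile at `C` is
that of `T` (`BuiltFrom.good_total`).

On the side of graphs this needs that a `k`-tree can be constructed starting from any of its
`k`-cliques (`BuiltFrom.reroot`), that vertices of degree `k` can be removed from a sub-`k`-tree
(`InducesKTree.isNClique_or_erase`), and that sub-`k`-trees are induced subgraphs
(`InducesKTree.adj_of_le`), so that they may be counted as vertex sets.
-/

namespace KTree

/-! ### Profiles of rooted k-trees -/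

/-- The numerical data of a `k`-tree with a root clique `C`: the number `n` of sub-`k`-trees
containing `C`, the average `δ` of `|X| - k` over them, the number `nb` of all sub-`k`-trees, and
the sum `db` of `|X| - k` over all of them. -/
structure Profile where
  n : ℚ
  δ : ℚ
  nb : ℚ
  db : ℚ

namespace Profile

/-- The profile of the complete graph on the root clique. -/
def unit : Profile := ⟨1, 0, 1, 0⟩

/-- The profile of two rooted `k`-trees glued along their common root clique. -/
def merge (a b : Profile) : Profile where
  n := a.n * b.n
  δ := a.δ + b.δ
  nb := a.n * b.n + (a.nb - a.n) + (b.nb - b.n)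
  db := a.n * b.n * (a.δ + b.δ) + (a.db - a.n * a.δ) + (b.db - b.n * b.δ)

/-- The profile of a root clique with a new vertex joined to it, where a rooted `k`-tree with
profile `d j` hangs at each of the `k` other cliques `j ∈ s` that the new vertex creates. -/
def extend {ι : Type*} (s : Finset ι) (d : ι → Profile) : Profile where
  n := 1 + ∏ j ∈ s, (d j).n
  δ := (∏ j ∈ s, (d j).n) * (1 + ∑ j ∈ s, (d j).δ) / (1 + ∏ j ∈ s, (d j).n)
  nb := 1 + (∏ j ∈ s, (d j).n) + ∑ j ∈ s, (d j).nb
  db := (∏ j ∈ s, (d j).n) * (1 + ∑ j ∈ s, (d j).δ) + ∑ j ∈ s, (d j).db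

/-- The inequalities carried through the induction. The last one, which reads
`(k + δ) * nb ≤ 2 * (k * nb + db) - k`, is the theorem with an additional error term `k`; the
others are what is needed to propagate it. -/
structure Good (k : ℚ) (d : Profile) : Prop where
  δ_nonneg : 0 ≤ d.δ
  n_eq_or : d.n = 1 ∨ 2 ≤ d.n
  δ_le : 2 * d.δ ≤ d.n - 1
  nb_le : d.nb ≤ d.n * (k + d.δ) - k + 1
  main : d.δ * d.nb ≤ k * (d.nb - 1) + 2 * d.db

variable {k : ℚ} {a b d : Profile}

theorem Good.one_le (h : Good k d) : 1 ≤ d.n := by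
  have := h.n_eq_or
  grind

theorem good_unit : Good k unit := by
  constructor <;> simp [unit]

/-- Gluing along the root clique preserves the inequalities. -/
theorem Good.merge (hk : 1 ≤ k) (ha : Good k a) (hb : Good k b) : Good k (merge a b) := by
  have ha1 := ha.one_le
  have hb1 := hb.one_le
  obtain ⟨ha0, haN, haD, haB, haM⟩ := ha
  obtain ⟨hb0, hbN, hbD, hbB, hbM⟩ := hb
  obtain ⟨x, p, A, A'⟩ := a
  obtain ⟨y, q, B, B'⟩ := b
  simp only [Profile.merge] at *
  obtain ⟨u, rfl⟩ : ∃ u, x = u + 1 := ⟨x - 1, by ring⟩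
  obtain ⟨v, rfl⟩ : ∃ v, y = v + 1 := ⟨y - 1, by ring⟩
  have hu : 0 ≤ u := by linarith
  have hv : 0 ≤ v := by linarith
  have huv : 0 ≤ u * v := mul_nonneg hu hv
  have hpv : 2 * (p * v) ≤ u * v := by nlinarith
  have hqu : 2 * (q * u) ≤ u * v := by nlinarith
  refine ⟨by simp only; linarith, ?_, ?_, ?_, ?_⟩ <;> simp only
  · rcases haN with h | h
    · simpa [h] using hbN
    · right
      nlinarith
  · nlinarith
  · have h1 : 0 ≤ (k - 1) * (u * v) := mul_nonneg (by linarith) huv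
    have h2 : 0 ≤ p * v * (u + 1) := by positivity
    have h3 : 0 ≤ q * u * (v + 1) := by positivity
    nlinarith
  · have e1 : q * (A - (u + 1)) ≤ q * ((u + 1) * (k - 1 + p) - (k - 1)) :=
      mul_le_mul_of_nonneg_left (by linarith) hb0
    have e2 : p * (B - (v + 1)) ≤ p * ((v + 1) * (k - 1 + q) - (k - 1)) :=
      mul_le_mul_of_nonneg_left (by linarith) ha0
    have e3 : 0 ≤ (k - 1) * (u * v - q * u - p * v) := mul_nonneg (by linarith) (by linarith)
    have e4 : 0 ≤ p * (u + 1) * (v - 2 * q) := by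
      apply mul_nonneg <;> [positivity; linarith]
    have e5 : 0 ≤ q * (v + 1) * (u - 2 * p) := by
      apply mul_nonneg <;> [positivity; linarith]
    have e6 : 0 ≤ p * (u + 1) * v := by positivity
    have e7 : 0 ≤ q * (v + 1) * u := by positivity
    linarith

end Profile

section Sums

variable {ι : Type*} {s : Finset ι} {m : ι → ℚ}

/-- The terms of degree at most two of the expanded product; the sum on the left is twice the
second elementary symmetric polynomial. -/
theorem one_add_sum_add_le_prod (hm : ∀ j ∈ s, 0 ≤ m j) :
    1 + ∑ j ∈ s, m j + (∑ j ∈ s, m j * (∑ i ∈ s, m i - m j)) / 2 ≤ ∏ j ∈ s, (1 + m j) := by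
  classical
  have key : ∀ t : Finset ι, ∑ j ∈ t, m j * (∑ i ∈ t, m i - m j) =
      (∑ j ∈ t, m j) ^ 2 - ∑ j ∈ t, m j ^ 2 := by
    intro t
    simp only [mul_sub, Finset.sum_sub_distrib, ← Finset.sum_mul]
    simp only [sq]
  rw [key]
  induction s using Finset.induction_on with
  | empty => simp
  | insert a t ha ih =>
    rw [Finset.sum_insert ha, Finset.sum_insert ha, Finset.prod_insert ha]
    have h0 : 0 ≤ m a := hm a (by simp)
    have ih' := ih fun j hj => hm j (by simp [hj])
    have h1 : 0 ≤ ∑ j ∈ t, m j := Finset.sum_nonneg fun j hj => hm j (by simp [hj])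
    have h2 : ∑ j ∈ t, m j ^ 2 ≤ (∑ j ∈ t, m j) ^ 2 :=
      Finset.sum_sq_le_sq_sum_of_nonneg fun j hj => hm j (by simp [hj])
    nlinarith [mul_le_mul_of_nonneg_left ih' h0, mul_nonneg h0 (sub_nonneg.2 h2)]

theorem one_add_sum_le_prod (hm : ∀ j ∈ s, 0 ≤ m j) :
    1 + ∑ j ∈ s, m j ≤ ∏ j ∈ s, (1 + m j) := by
  have h1 := one_add_sum_add_le_prod hm
  have h2 : 0 ≤ ∑ j ∈ s, m j * (∑ i ∈ s, m i - m j) := Finset.sum_nonneg fun j hj =>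
    mul_nonneg (hm j hj) (sub_nonneg.2 (Finset.single_le_sum hm hj))
  linarith

end Sums

namespace Profile

variable {ι : Type*} {s : Finset ι} {d : ι → Profile}

/-- The estimate to which the inductive step for `extend` reduces, when at most one of the hanging
`k`-trees is more than its root clique. -/
theorem extend_bound_single (hs : 1 ≤ s.card) (h : ∀ j ∈ s, Good s.card (d j)) (i : ι) (hi : i ∈ s)
    (htriv : ∀ j ∈ s, j ≠ i → (d j).n = 1) :
    ∑ j ∈ s, ((extend s d).δ - (d j).δ) * (1 + s.card * ((d j).n - 1) + (d j).n * (d j).δ) ≤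
      s.card * (∏ j ∈ s, (d j).n) + (s.card : ℚ) ^ 2 +
        (∏ j ∈ s, (d j).n) * (1 + ∑ j ∈ s, (d j).δ) := by
  classical
  have hδ : ∀ j ∈ s, j ≠ i → (d j).δ = 0 := fun j hj hji => by
    have h1 := (h j hj).δ_nonneg
    have h2 := (h j hj).δ_le
    rw [htriv j hj hji] at h2
    linarith
  have hP : ∏ j ∈ s, (d j).n = (d i).n := Finset.prod_eq_single_of_mem i hi htriv
  have hD : ∑ j ∈ s, (d j).δ = (d i).δ := Finset.sum_eq_single_of_mem i hi hδ
  have hE : (extend s d).δ = (d i).n * (1 + (d i).δ) / (1 + (d i).n) := by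
    simp only [extend, hP, hD]
  have hlast : ∑ j ∈ s.erase i,
      ((extend s d).δ - (d j).δ) * (1 + s.card * ((d j).n - 1) + (d j).n * (d j).δ) =
      (s.card - 1) * (extend s d).δ := by
    rw [Finset.sum_congr rfl (g := fun _ => (extend s d).δ), Finset.sum_const,
      Finset.card_erase_of_mem hi, nsmul_eq_mul, Nat.cast_sub hs, Nat.cast_one]
    intro j hj
    obtain ⟨hji, hj⟩ := Finset.mem_erase.1 hj
    rw [htriv j hj hji, hδ j hj hji]
    ring
  rw [← Finset.add_sum_erase s _ hi, hlast, hP, hD]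
  have h1 := (h i hi).one_le
  have h0 := (h i hi).δ_nonneg
  have h2 := (h i hi).δ_le
  have hk : (1 : ℚ) ≤ s.card := by exact_mod_cast hs
  generalize (d i).n = P at *
  generalize (d i).δ = p at *
  generalize (extend s d).δ = r at *
  generalize (s.card : ℚ) = k at *
  have hr : r * (1 + P) = P * (1 + p) := by rw [hE]; field_simp
  have hrp : p ≤ r := by
    rw [hE, le_div_iff₀ (by linarith)]
    nlinarith
  have e1 : (r - p) * (P * (k + p)) = P * (k + p) - r * (k + p) := by
    linear_combination (k + p) * hr
  have e2 : 0 ≤ (k - 1) * (r - p) := mul_nonneg (by linarith) (by linarith)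
  have e3 : 0 ≤ r * p := mul_nonneg (by linarith) h0
  nlinarith

/-- The estimate to which the inductive step for `extend` reduces, when at least two of the hanging
`k`-trees are more than their root cliques. -/
theorem extend_bound_multi (h : ∀ j ∈ s, Good s.card (d j))
    (hmulti : ∀ j ∈ s, ∃ i ∈ s, i ≠ j ∧ 2 ≤ (d i).n) :
    ∑ j ∈ s, ((extend s d).δ - (d j).δ) * (1 + s.card * ((d j).n - 1) + (d j).n * (d j).δ) ≤
      s.card * (∏ j ∈ s, (d j).n) + (s.card : ℚ) ^ 2 +
        (∏ j ∈ s, (d j).n) * (1 + ∑ j ∈ s, (d j).δ) := by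
  classical
  obtain ⟨m, hm⟩ : ∃ m : ι → ℚ, ∀ j, (d j).n = 1 + m j := ⟨fun j => (d j).n - 1, by simp⟩
  obtain ⟨p, hp⟩ : ∃ p : ι → ℚ, ∀ j, (d j).δ = p j := ⟨fun j => (d j).δ, by simp⟩
  have hm0 : ∀ j ∈ s, 0 ≤ m j := fun j hj => by
    have := (h j hj).one_le
    rw [hm] at this
    linarith
  have hp0 : ∀ j ∈ s, 0 ≤ p j := fun j hj => hp j ▸ (h j hj).δ_nonneg
  have hpm : ∀ j ∈ s, 2 * p j ≤ m j := fun j hj => by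
    have := (h j hj).δ_le
    rw [hm, hp] at this
    linarith
  have hE : (extend s d).δ ≤ 1 + ∑ j ∈ s, p j := by
    have h1 : (0 : ℚ) ≤ ∏ j ∈ s, (1 + m j) :=
      Finset.prod_nonneg fun j hj => by linarith [hm0 j hj]
    have h2 := Finset.sum_nonneg hp0
    simp only [extend, hm, hp]
    rw [div_le_iff₀ (by linarith)]
    nlinarith
  simp only [hm, hp]
  set k : ℚ := (s.card : ℚ) with hk
  have hk0 : 0 ≤ k := by positivity
  set P := ∏ j ∈ s, (1 + m j) with hP
  set S := ∑ j ∈ s, m j with hS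
  set Δ := ∑ j ∈ s, p j with hΔ
  set Q := ∑ j ∈ s, m j * (S - m j) with hQ
  have hΔ0 : 0 ≤ Δ := Finset.sum_nonneg hp0
  have hmS : ∀ j ∈ s, 0 ≤ S - m j := fun j hj => by
    linarith [Finset.single_le_sum hm0 hj]
  have hP2 : 1 + S + Q / 2 ≤ P := one_add_sum_add_le_prod hm0
  -- As another hanging tree is nontrivial, `P` exceeds `(1 + m j) * (1 + (Δ - p j))` by at least
  -- `p j`. The resulting terms `-p j ^ 2`, with `k ^ 2` and `P`, outweigh `k * Δ` at the end.
  have hroom : ∀ j ∈ s, 1 ≤ S - m j := fun j hj => by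
    obtain ⟨i, hi, hij, hi2⟩ := hmulti j hj
    have h1 : m i ≤ ∑ l ∈ s.erase j, m l :=
      Finset.single_le_sum (fun l hl => hm0 l (Finset.mem_of_mem_erase hl))
        (Finset.mem_erase.2 ⟨hij, hi⟩)
    rw [hm] at hi2
    linarith [Finset.add_sum_erase s m hj]
  have hprod : ∀ j ∈ s, (1 + m j) * (1 + (S - m j)) ≤ P := fun j hj => by
    have h1 := one_add_sum_le_prod (s := s.erase j) (m := m)
      fun l hl => hm0 l (Finset.mem_of_mem_erase hl)
    rw [hP, ← Finset.mul_prod_erase s _ hj]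
    refine mul_le_mul_of_nonneg_left ?_ (by linarith [hm0 j hj])
    linarith [Finset.add_sum_erase s m hj]
  have hΔj : ∀ j ∈ s, 2 * (Δ - p j) ≤ S - m j := fun j hj => by
    have : ∑ l ∈ s.erase j, 2 * p l ≤ ∑ l ∈ s.erase j, m l :=
      Finset.sum_le_sum fun l hl => hpm l (Finset.mem_of_mem_erase hl)
    rw [← Finset.mul_sum] at this
    linarith [Finset.add_sum_erase s m hj, Finset.add_sum_erase s p hj]
  have hΔp : ∀ j ∈ s, 0 ≤ Δ - p j := fun j hj => by
    linarith [Finset.single_le_sum hp0 hj]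
  have step : ∀ j ∈ s, ((extend s d).δ - p j) * (1 + k * (1 + m j - 1) + (1 + m j) * p j) ≤
      (1 + Δ) - p j + k * m j + k / 2 * (m j * (S - m j)) + P * p j - p j ^ 2 := fun j hj => by
    have a1 := hm0 j hj
    have a2 := hp0 j hj
    have a3 := hpm j hj
    have e1 : ((extend s d).δ - p j) * (1 + k * (1 + m j - 1) + (1 + m j) * p j) ≤
        (1 + (Δ - p j)) * (1 + k * (1 + m j - 1) + (1 + m j) * p j) := by
      refine mul_le_mul_of_nonneg_right (by linarith) ?_
      have := mul_nonneg hk0 a1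
      have := mul_nonneg (a := 1 + m j) (by linarith) a2
      linarith
    have e2 : k * m j * (2 * (Δ - p j)) ≤ k * m j * (S - m j) :=
      mul_le_mul_of_nonneg_left (hΔj j hj) (mul_nonneg hk0 a1)
    have e3 : (1 + m j) * (1 + (Δ - p j)) ≤ P - p j := by
      have b1 := hprod j hj
      have b2 : (1 + m j) * (2 * (Δ - p j)) ≤ (1 + m j) * (S - m j) :=
        mul_le_mul_of_nonneg_left (hΔj j hj) (by linarith)
      have b3 : (1 + m j) * 1 ≤ (1 + m j) * (S - m j) :=
        mul_le_mul_of_nonneg_left (hroom j hj) (by linarith)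
      linarith
    have e4 := mul_le_mul_of_nonneg_left e3 a2
    linarith
  refine (Finset.sum_le_sum step).trans ?_
  simp only [Finset.sum_sub_distrib, Finset.sum_add_distrib, ← Finset.mul_sum, Finset.sum_const,
    nsmul_eq_mul]
  rw [← hk, ← hS, ← hΔ, ← hQ]
  have hQΔ : 4 * (Δ ^ 2 - ∑ j ∈ s, p j ^ 2) ≤ Q := by
    have : ∑ j ∈ s, 4 * (p j * (Δ - p j)) ≤ Q := Finset.sum_le_sum fun j hj => by
      nlinarith [mul_le_mul (hpm j hj) (hΔj j hj) (by linarith [hΔp j hj]) (hm0 j hj)]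
    refine le_trans (le_of_eq ?_) this
    simp only [mul_sub, Finset.sum_sub_distrib, ← Finset.mul_sum, ← Finset.sum_mul, ← hΔ]
    simp only [sq]
  have hsq : ∑ j ∈ s, p j ^ 2 ≤ Δ ^ 2 := Finset.sum_sq_le_sq_sum_of_nonneg hp0
  have hS0 : 0 ≤ S := Finset.sum_nonneg hm0
  have e1 := mul_le_mul_of_nonneg_left hP2 hk0
  nlinarith [sq_nonneg (2 * k - Δ)]

/-- Joining a new vertex to the root clique, with rooted `k`-trees satisfying the inequalities at
the new cliques, yields a rooted `k`-tree satisfying them. -/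
theorem Good.extend (hs : 1 ≤ s.card) (h : ∀ j ∈ s, Good s.card (d j)) :
    Good s.card (extend s d) := by
  classical
  -- What remains of `main` once `nb_le` and `main` are inserted for each hanging tree.
  have hbound : ∑ j ∈ s, ((Profile.extend s d).δ - (d j).δ) *
        (1 + s.card * ((d j).n - 1) + (d j).n * (d j).δ) ≤
      s.card * (∏ j ∈ s, (d j).n) + (s.card : ℚ) ^ 2 +
        (∏ j ∈ s, (d j).n) * (1 + ∑ j ∈ s, (d j).δ) := by
    by_cases hm : ∀ j ∈ s, ∃ i ∈ s, i ≠ j ∧ 2 ≤ (d i).n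
    · exact extend_bound_multi h hm
    · push Not at hm
      obtain ⟨i, hi, hi'⟩ := hm
      exact extend_bound_single hs h i hi fun j hj hji =>
        (h j hj).n_eq_or.resolve_right (not_le.2 (hi' j hj hji))
  have hk : (1 : ℚ) ≤ s.card := by exact_mod_cast hs
  have hn : ∀ j ∈ s, 1 ≤ (d j).n := fun j hj => (h j hj).one_le
  have hδ0 : ∀ j ∈ s, 0 ≤ (d j).δ := fun j hj => (h j hj).δ_nonneg
  have hΔ0 := Finset.sum_nonneg hδ0
  have hsum : 1 + ∑ j ∈ s, ((d j).n - 1) ≤ ∏ j ∈ s, (d j).n := by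
    have := one_add_sum_le_prod (s := s) (m := fun j => (d j).n - 1)
      fun j hj => by linarith [hn j hj]
    simpa using this
  have hP1 : 1 ≤ ∏ j ∈ s, (d j).n := by
    have : 0 ≤ ∑ j ∈ s, ((d j).n - 1) :=
      Finset.sum_nonneg fun j hj => sub_nonneg.2 (hn j hj)
    linarith
  have hnP : ∀ j ∈ s, (d j).n ≤ ∏ j ∈ s, (d j).n := fun j hj => by
    have h1 := Finset.single_le_sum (f := fun j => (d j).n - 1)
      (fun j hj => by linarith [hn j hj]) hj
    linarith
  have hδle : 2 * ∑ j ∈ s, (d j).δ ≤ ∑ j ∈ s, ((d j).n - 1) := by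
    rw [Finset.mul_sum]
    exact Finset.sum_le_sum fun j hj => (h j hj).δ_le
  have hmul : (Profile.extend s d).δ * (1 + ∏ j ∈ s, (d j).n) =
      (∏ j ∈ s, (d j).n) * (1 + ∑ j ∈ s, (d j).δ) := by
    simp only [Profile.extend]
    field_simp
  have hge : ∀ j ∈ s, (d j).δ ≤ (Profile.extend s d).δ := fun j hj => by
    have h1 := Finset.single_le_sum hδ0 hj
    have h2 := (h j hj).δ_le
    have h3 := hnP j hj
    refine le_of_mul_le_mul_right (a := 1 + ∏ j ∈ s, (d j).n) ?_ (by linarith)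
    rw [hmul]
    have h4 := mul_le_mul_of_nonneg_left h1 (a := ∏ j ∈ s, (d j).n) (by linarith)
    have h5 := hδ0 j hj
    linarith
  have hnb : ∀ j ∈ s, (d j).nb ≤ 1 + s.card * ((d j).n - 1) + (d j).n * (d j).δ := fun j hj => by
    linarith [(h j hj).nb_le]
  refine ⟨?_, ?_, ?_, ?_, ?_⟩
  · simp only [Profile.extend]
    positivity
  · right
    simp only [Profile.extend]
    linarith
  · refine le_of_mul_le_mul_right (a := 1 + ∏ j ∈ s, (d j).n) ?_ (by linarith)
    rw [mul_assoc, hmul]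
    simp only [Profile.extend]
    nlinarith
  · have h1 : ∑ j ∈ s, (d j).nb ≤
        ∑ j ∈ s, (1 + s.card * ((d j).n - 1) + (∏ j ∈ s, (d j).n) * (d j).δ) :=
      Finset.sum_le_sum fun j hj => (hnb j hj).trans <| by
        linarith [mul_le_mul_of_nonneg_right (hnP j hj) (hδ0 j hj)]
    simp only [Finset.sum_add_distrib, ← Finset.mul_sum, Finset.sum_const, nsmul_eq_mul,
      mul_one] at h1
    have h2 := mul_le_mul_of_nonneg_left hsum (a := (s.card : ℚ)) (by linarith)
    have h3 : (Profile.extend s d).n * (s.card + (Profile.extend s d).δ) =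
        (1 + ∏ j ∈ s, (d j).n) * s.card + (∏ j ∈ s, (d j).n) * (1 + ∑ j ∈ s, (d j).δ) := by
      rw [← hmul]
      simp only [Profile.extend]
      ring
    rw [h3]
    simp only [Profile.extend]
    linarith
  · have h1 : ∑ j ∈ s, ((Profile.extend s d).δ - (d j).δ) * (d j).nb ≤ _ :=
      (Finset.sum_le_sum fun j hj => mul_le_mul_of_nonneg_left (hnb j hj)
        (sub_nonneg.2 (hge j hj))).trans hbound
    have h2 : ∑ j ∈ s, (d j).δ * (d j).nb ≤ ∑ j ∈ s, (s.card * ((d j).nb - 1) + 2 * (d j).db) :=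
      Finset.sum_le_sum fun j hj => (h j hj).main
    simp only [sub_mul, Finset.sum_sub_distrib, ← Finset.mul_sum] at h1
    simp only [Finset.sum_add_distrib, ← Finset.mul_sum, Finset.sum_sub_distrib, Finset.sum_const,
      nsmul_eq_mul, mul_one] at h2
    have h3 : (Profile.extend s d).nb = 1 + (∏ j ∈ s, (d j).n) + ∑ j ∈ s, (d j).nb := rfl
    have h4 : (Profile.extend s d).db =
      (∏ j ∈ s, (d j).n) * (1 + ∑ j ∈ s, (d j).δ) + ∑ j ∈ s, (d j).db := rfl
    rw [h3, h4, mul_add, hmul]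
    linarith

end Profile

/-! ### Vertex sets inducing k-trees -/

section Graph

open Classical

variable {V : Type u} {G H : SimpleGraph V} {k : ℕ} {C D W X : Finset V} {v : V}

/-- `BuiltFrom G k C W`: the subgraph of `G` induced on `W` arises from the vertex set `C` by
successively joining new vertices to `k`-cliques. For a `k`-clique `C` this says that it is a
`k`-tree containing `C`, constructed starting from `C`. -/
inductive BuiltFrom (G : SimpleGraph V) (k : ℕ) (C : Finset V) : Finset V → Prop
  | base : BuiltFrom G k C C
  | join {W D : Finset V} {v : V} (h : BuiltFrom G k C W) (hv : v ∉ W) (hD : G.IsNClique k D)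
      (hDW : D ⊆ W) (hadj : ∀ w ∈ W, G.Adj v w ↔ w ∈ D) : BuiltFrom G k C (insert v W)

/-- `InducesKTree G k W`: the subgraph of `G` induced on the finite set `W` is a `k`-tree. -/
def InducesKTree (G : SimpleGraph V) (k : ℕ) (W : Finset V) : Prop :=
  ∃ C, G.IsNClique k C ∧ BuiltFrom G k C W

theorem BuiltFrom.subset (h : BuiltFrom G k C W) : C ⊆ W := by
  induction h with
  | base => exact subset_rfl
  | join _ _ _ _ _ ih => exact ih.trans (Finset.subset_insert _ _)

theorem InducesKTree.of_isNClique (h : G.IsNClique k C) : InducesKTree G k C :=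
  ⟨C, h, .base⟩

theorem InducesKTree.join (h : InducesKTree G k W) (hv : v ∉ W) (hD : G.IsNClique k D)
    (hDW : D ⊆ W) (hadj : ∀ w ∈ W, G.Adj v w ↔ w ∈ D) : InducesKTree G k (insert v W) :=
  let ⟨C, hC, h⟩ := h
  ⟨C, hC, h.join hv hD hDW hadj⟩

theorem InducesKTree.card_le (h : InducesKTree G k W) : k ≤ W.card :=
  let ⟨_, hC, h⟩ := h
  hC.card_eq ▸ Finset.card_le_card h.subset

/-- A new vertex together with all but one vertex of the clique it is joined to. -/
theorem isNClique_insert_erase (hD : G.IsNClique k D) (hadj : ∀ w ∈ D, G.Adj v w) {u : V}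
    (hu : u ∈ D) : G.IsNClique k (insert v (D.erase u)) := by
  have hpos : 0 < k := hD.card_eq ▸ Finset.card_pos.2 ⟨u, hu⟩
  have h1 : G.IsNClique (k - 1) (D.erase u) :=
    ⟨hD.isClique.subset (by simp), by rw [Finset.card_erase_of_mem hu, hD.card_eq]⟩
  have := h1.insert (a := v) fun b hb => hadj b (Finset.mem_of_mem_erase hb)
  rwa [Nat.sub_add_cancel hpos] at this

theorem erase_subset_of_isClique (hadj : ∀ w ∈ W, G.Adj v w ↔ w ∈ D)
    (hX : G.IsClique (X : Set V)) (hvX : v ∈ X) (hXW : X ⊆ insert v W) : X.erase v ⊆ D := by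
  intro w hw
  obtain ⟨hwv, hwX⟩ := Finset.mem_erase.1 hw
  have hwW := Finset.mem_of_mem_insert_of_ne (hXW hwX) hwv
  exact (hadj w hwW).1 (hX hvX hwX hwv.symm)

/-- The `k`-cliques through a vertex joined to the clique `D`. -/
theorem exists_eq_insert_erase (hk : 1 ≤ k) (hD : G.IsNClique k D)
    (hadj : ∀ w ∈ W, G.Adj v w ↔ w ∈ D) (hX : G.IsNClique k X) (hvX : v ∈ X)
    (hXW : X ⊆ insert v W) : ∃ u ∈ D, X = insert v (D.erase u) := by
  have hsub := erase_subset_of_isClique hadj hX.isClique hvX hXW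
  have hcard : (X.erase v).card + 1 = D.card := by
    rw [Finset.card_erase_of_mem hvX, hX.card_eq, hD.card_eq, Nat.sub_add_cancel hk]
  obtain ⟨u, hu, h⟩ : ∃ u ∉ X.erase v, insert u (X.erase v) = D :=
    Finset.exists_eq_insert_iff.2 ⟨hsub, hcard⟩ |>.imp fun _ h => h
  refine ⟨u, h ▸ Finset.mem_insert_self _ _, ?_⟩
  rw [← h, Finset.erase_insert hu, Finset.insert_erase hvX]

/-- The construction of a `k`-tree from `D`, followed by joining `v` to `D`, can be rearranged so
as to start from another clique of the `(k + 1)`-clique `D ∪ {v}`. -/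
theorem BuiltFrom.insert_erase (h : BuiltFrom G k D W) (hD : G.IsNClique k D) (hv : v ∉ W)
    (hadj : ∀ w ∈ W, G.Adj v w ↔ w ∈ D) {u : V} (hu : u ∈ D) :
    BuiltFrom G k (insert v (D.erase u)) (insert v W) := by
  induction h with
  | base =>
    have hc := isNClique_insert_erase hD (fun w hw => (hadj w hw).2 hw) hu
    have huv : u ≠ v := fun h => hv (h ▸ hu)
    have : insert v D = insert u (insert v (D.erase u)) := by
      rw [Finset.insert_comm, Finset.insert_erase hu]
    rw [this]
    refine BuiltFrom.base.join (by simp [huv]) hc subset_rfl fun w hw => iff_of_true ?_ hw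
    rcases Finset.mem_insert.1 hw with rfl | hw
    · exact ((hadj u hu).2 hu).symm
    · obtain ⟨hwu, hw⟩ := Finset.mem_erase.1 hw
      exact hD.isClique hu hw hwu.symm
  | @join W' F x h hx hF hFW hadjx ih =>
    have hvx : v ≠ x := fun h => hv (h ▸ Finset.mem_insert_self _ _)
    have hvW : v ∉ W' := fun h => hv (Finset.mem_insert_of_mem h)
    rw [Finset.insert_comm]
    refine (ih hvW fun w hw => hadj w (Finset.mem_insert_of_mem hw)).join
      (by simp [hvx.symm, hx]) hF (hFW.trans (Finset.subset_insert _ _)) fun w hw => ?_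
    rcases Finset.mem_insert.1 hw with rfl | hw
    · refine iff_of_false (fun hxw => ?_) fun h => hvW (hFW h)
      exact hx (h.subset ((hadj x (Finset.mem_insert_self _ _)).1 hxw.symm))
    · exact hadjx w hw

/-- A `k`-tree can be constructed starting from any of its `k`-cliques. -/
theorem BuiltFrom.reroot {C₀ : Finset V} (hk : 1 ≤ k) (h : BuiltFrom G k C₀ W)
    (hC₀ : G.IsNClique k C₀) (hC : G.IsNClique k C) (hCW : C ⊆ W) : BuiltFrom G k C W := by
  induction h generalizing C with
  | base =>
    rw [Finset.eq_of_subset_of_card_le hCW (by rw [hC.card_eq, hC₀.card_eq])]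
    exact .base
  | @join W D v h hv hD hDW hadj ih =>
    by_cases hvC : v ∈ C
    · obtain ⟨u, hu, rfl⟩ := exists_eq_insert_erase hk hD hadj hC hvC hCW
      exact (ih hD hDW).insert_erase hD hv hadj hu
    · exact (ih hC ((Finset.subset_insert_iff_of_notMem hvC).1 hCW)).join hv hD hDW hadj

/-- A vertex `v` with at most `k` neighbours in a `k`-tree can be removed, unless the `k`-tree
is a single `k`-clique. -/
theorem InducesKTree.isNClique_or_erase (hX : InducesKTree G k X) (hvX : v ∈ X)
    (hDk : D.card = k) (hadj : ∀ w ∈ X, G.Adj v w → w ∈ D) :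
    G.IsNClique k X ∨ (D ⊆ X ∧ (∀ w ∈ D, G.Adj v w) ∧ InducesKTree G k (X.erase v)) := by
  obtain ⟨C, hC, h⟩ := hX
  induction h with
  | base => exact .inl hC
  | @join X F x h hx hF hFX hadjx ih =>
    right
    rcases eq_or_ne v x with rfl | hvx
    · have hFD : F = D := by
        refine Finset.eq_of_subset_of_card_le (fun w hw => ?_) (by rw [hDk, hF.card_eq])
        exact hadj w (Finset.mem_insert_of_mem (hFX hw)) ((hadjx w (hFX hw)).2 hw)
      subst hFD
      refine ⟨hFX.trans (Finset.subset_insert _ _), fun w hw => (hadjx w (hFX hw)).2 hw, ?_⟩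
      rw [Finset.erase_insert hx]
      exact ⟨C, hC, h⟩
    · have hvX' : v ∈ X := Finset.mem_of_mem_insert_of_ne hvX hvx
      rcases ih hvX' fun w hw => hadj w (Finset.mem_insert_of_mem hw) with hXc | ⟨hDX, hDv, hXv⟩
      · -- Here `X ∪ {x}` is a `(k + 1)`-clique, from which any vertex can be removed.
        have hFeq : F = X :=
          Finset.eq_of_subset_of_card_le hFX (by rw [hXc.card_eq, hF.card_eq])
        subst hFeq
        have hcl : G.IsNClique (k + 1) (insert x F) :=
          hF.insert fun b hb => (hadjx b hb).2 hb
        have hcl' : ∀ w ∈ (insert x F).erase v, G.Adj v w := fun w hw =>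
          hcl.isClique hvX (Finset.mem_of_mem_erase hw) (Finset.ne_of_mem_erase hw).symm
        have hDeq : (insert x F).erase v = D := by
          refine Finset.eq_of_subset_of_card_le
            (fun w hw => hadj w (Finset.mem_of_mem_erase hw) (hcl' w hw)) ?_
          rw [Finset.card_erase_of_mem hvX, hcl.card_eq, hDk, Nat.add_sub_cancel]
        refine ⟨hDeq ▸ Finset.erase_subset _ _, hDeq ▸ hcl', .of_isNClique ⟨?_, ?_⟩⟩
        · exact hcl.isClique.subset (Finset.coe_subset.2 (Finset.erase_subset _ _))
        · rw [hDeq, hDk]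
      · refine ⟨hDX.trans (Finset.subset_insert _ _), hDv, ?_⟩
        have hvF : v ∉ F := fun hvF =>
          hx (hDX (hadj x (Finset.mem_insert_self _ _) ((hadjx v hvX').2 hvF).symm))
        rw [Finset.erase_insert_of_ne hvx.symm]
        refine hXv.join (fun h => hx (Finset.mem_of_mem_erase h)) hF
          (fun w hw => Finset.mem_erase.2 ⟨fun h => hvF (h ▸ hw), hFX hw⟩)
          fun w hw => hadjx w (Finset.mem_of_mem_erase hw)

/-- Sub-`k`-trees of a `k`-tree are induced subgraphs. -/
theorem InducesKTree.adj_of_le (hHG : H ≤ G) (hW : InducesKTree G k W)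
    (hX : InducesKTree H k X) (hXW : X ⊆ W) {a b : V} (ha : a ∈ X) (hb : b ∈ X)
    (hab : G.Adj a b) : H.Adj a b := by
  obtain ⟨C, hC, h⟩ := hW
  induction h generalizing X a b with
  | base =>
    obtain ⟨E, hE, h⟩ := hX
    have hEX : E = X := Finset.eq_of_subset_of_card_le h.subset <| by
      rw [hE.card_eq, ← hC.card_eq]
      exact Finset.card_le_card hXW
    exact hE.isClique (hEX ▸ ha) (hEX ▸ hb) hab.ne
  | @join W D v _ hv hD hDW hadj ih =>
    by_cases hvX : v ∈ X
    · have hnb : ∀ w ∈ X, G.Adj v w → w ∈ D := fun w hw hvw =>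
        (hadj w (Finset.mem_of_mem_insert_of_ne (hXW hw) hvw.ne')).1 hvw
      rcases hX.isNClique_or_erase hvX hD.card_eq fun w hw hvw => hnb w hw (hHG hvw) with
        hc | ⟨-, hDv, hXv⟩
      · exact hc.isClique ha hb hab.ne
      · rcases eq_or_ne a v with rfl | hav
        · exact hDv b (hnb b hb hab)
        · rcases eq_or_ne b v with rfl | hbv
          · exact (hDv a (hnb a ha hab.symm)).symm
          · exact ih hXv (Finset.subset_insert_iff.1 hXW) (Finset.mem_erase.2 ⟨hav, ha⟩)
              (Finset.mem_erase.2 ⟨hbv, hb⟩) hab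
    · exact ih hX ((Finset.subset_insert_iff_of_notMem hvX).1 hXW) ha hb hab

theorem InducesKTree.congr (h : InducesKTree H k W)
    (hHG : ∀ a ∈ W, ∀ b ∈ W, H.Adj a b ↔ G.Adj a b) : InducesKTree G k W := by
  have clique : ∀ {E : Finset V}, H.IsNClique k E → (∀ a ∈ E, ∀ b ∈ E, H.Adj a b ↔ G.Adj a b) →
      G.IsNClique k E := fun hE h =>
    ⟨fun a ha b hb hab => (h a ha b hb).1 (hE.isClique ha hb hab), hE.card_eq⟩
  obtain ⟨C, hC, h⟩ := h
  induction h with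
  | base => exact .of_isNClique (clique hC hHG)
  | @join W D v h hv hD hDW hadj ih =>
    have hsub := Finset.subset_insert v W
    refine (ih fun a ha b hb => hHG a (hsub ha) b (hsub hb)).join hv
      (clique hD fun a ha b hb => hHG a (hsub (hDW ha)) b (hsub (hDW hb))) hDW fun w hw => ?_
    rw [← hadj w hw, hHG v (by simp) w (hsub hw)]

/-- An induced embedding `f` of a `k`-tree with range `W` shows that `W` induces a `k`-tree. -/
theorem _root_.IsKTree.inducesKTree {V' : Type u} {K : SimpleGraph V'} (h : IsKTree k K)
    (f : V' → V) (hf : Function.Injective f) (hadj : ∀ a b, G.Adj (f a) (f b) ↔ K.Adj a b)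
    (hW : ∀ w, w ∈ W ↔ w ∈ Set.range f) : InducesKTree G k W := by
  induction h generalizing W with
  | @complete V' K e =>
    have hWe : W = Finset.univ.map ⟨fun i => f (e.symm i), hf.comp e.symm.injective⟩ := by
      ext w
      rw [hW]
      simp [e.symm.surjective.exists]
    refine .of_isNClique ⟨?_, by simp [hWe]⟩
    intro a ha b hb hab
    obtain ⟨x, rfl⟩ := (hW a).1 ha
    obtain ⟨y, rfl⟩ := (hW b).1 hb
    rw [hadj, ← e.map_adj_iff, SimpleGraph.top_adj]
    exact fun h => hab (congrArg f (e.injective h))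
  | @join V' K v C h hC hv ih =>
    have hvW : f v ∈ W := (hW _).2 ⟨v, rfl⟩
    rw [← Finset.insert_erase hvW]
    refine (ih (W := W.erase (f v)) (fun x => f x.1) (hf.comp Subtype.val_injective)
      (fun a b => hadj _ _) ?_).join (D := C.map ⟨f, hf⟩) (by simp) ?_ ?_ ?_
    · intro w
      rw [Finset.mem_erase, hW]
      constructor
      · rintro ⟨hne, x, rfl⟩
        exact ⟨⟨x, fun h => hne (congrArg f h)⟩, rfl⟩
      · rintro ⟨x, rfl⟩
        exact ⟨fun h => x.2 (hf h), x.1, rfl⟩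
    · refine ⟨?_, by simp [hC.card_eq]⟩
      intro a ha b hb hab
      simp only [Finset.coe_map, Function.Embedding.coeFn_mk, Set.mem_image] at ha hb
      obtain ⟨x, hx, rfl⟩ := ha
      obtain ⟨y, hy, rfl⟩ := hb
      exact (hadj x y).2 (hC.isClique hx hy fun h => hab (congrArg f h))
    · intro w hw
      simp only [Finset.mem_map, Function.Embedding.coeFn_mk] at hw
      obtain ⟨x, hx, rfl⟩ := hw
      exact Finset.mem_erase.2 ⟨fun h => K.irrefl ((hv v).2 (hf h ▸ hx)), (hW _).2 ⟨x, rfl⟩⟩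
    · intro w hw
      obtain ⟨x, rfl⟩ := (hW w).1 (Finset.mem_of_mem_erase hw)
      rw [hadj, hv]
      simp

/-- Any graph isomorphic, through `f`, to the subgraph of `G` induced on `W` is a `k`-tree as soon as
`W` induces one. -/
theorem InducesKTree.isKTree (h : InducesKTree G k W) {V' : Type u} {K : SimpleGraph V'}
    (f : V' → V) (hf : Function.Injective f) (hadj : ∀ a b, G.Adj (f a) (f b) ↔ K.Adj a b)
    (hW : ∀ w, w ∈ W ↔ w ∈ Set.range f) : IsKTree k K := by
  have clique : ∀ {E : Finset V} {V' : Type u} {K : SimpleGraph V'} {f : V' → V}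
      (hf : Function.Injective f) (_ : ∀ a b, G.Adj (f a) (f b) ↔ K.Adj a b)
      (_ : ∀ w ∈ E, w ∈ Set.range f) (_ : G.IsNClique k E),
      K.IsNClique k (E.preimage f hf.injOn) := by
    intro E V' K f hf hadj hEf hE
    refine ⟨fun a ha b hb hab => (hadj a b).1 (hE.isClique ?_ ?_ (hf.ne hab)), ?_⟩
    · simpa using ha
    · simpa using hb
    · rw [Finset.card_preimage, Finset.filter_true_of_mem hEf, hE.card_eq]
  obtain ⟨C, hC, h⟩ := h
  induction h generalizing V' with
  | base =>
    have hK := clique hf hadj (fun w hw => (hW w).1 hw) hC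
    have hall : ∀ x, x ∈ C.preimage f hf.injOn := fun x => by simp [hW]
    have : Fintype V' := ⟨_, hall⟩
    have hcard : Fintype.card V' = k := by
      rw [← hK.card_eq, ← Finset.card_univ]
      congr 1
      ext x
      simp [hW]
    refine .complete ⟨Fintype.equivFinOfCardEq hcard, ?_⟩
    intro a b
    rw [SimpleGraph.top_adj, (Equiv.injective _).ne_iff]
    exact ⟨fun h => hK.isClique (hall a) (hall b) h, fun h => h.ne⟩
  | @join W D v h hv hD hDW hadj' ih =>
    obtain ⟨x, rfl⟩ := (hW v).1 (Finset.mem_insert_self _ _)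
    have hrange : ∀ w ∈ D, w ∈ Set.range f := fun w hw =>
      (hW w).1 (Finset.mem_insert_of_mem (hDW hw))
    refine .join x (D.preimage f hf.injOn)
      (ih (fun y => f y.1) (hf.comp Subtype.val_injective) (fun a b => hadj _ _) fun w => ?_)
      (clique hf hadj hrange hD) fun w => ?_
    · constructor
      · intro hw
        obtain ⟨y, rfl⟩ := (hW w).1 (Finset.mem_insert_of_mem hw)
        exact ⟨⟨y, fun h => hv (h ▸ hw)⟩, rfl⟩
      · rintro ⟨y, rfl⟩
        exact Finset.mem_of_mem_insert_of_ne ((hW _).2 ⟨y.1, rfl⟩) fun h => y.2 (hf h)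
    · rw [Finset.mem_preimage, ← hadj]
      rcases eq_or_ne w x with rfl | hwx
      · exact iff_of_false G.irrefl fun h => hv (hDW h)
      · exact hadj' _ (Finset.mem_of_mem_insert_of_ne ((hW _).2 ⟨w, rfl⟩) (hf.ne hwx))

end Graph

/-! ### Weighted counting of sub-k-trees -/

noncomputable section Totals

open Classical

variable {V : Type u} {G : SimpleGraph V} {k : ℕ} {C D W X Y : Finset V} {v : V}

/-- The `k`-cliques of `G` inside `X`. -/
def cliques (G : SimpleGraph V) (k : ℕ) (X : Finset V) : Finset (Finset V) :=
  X.powerset.filter (G.IsNClique k)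

/-- The vertex sets inside `W` that induce `k`-trees. -/
def kTreesIn (G : SimpleGraph V) (k : ℕ) (W : Finset V) : Finset (Finset V) :=
  W.powerset.filter (InducesKTree G k)

@[simp]
theorem mem_cliques : C ∈ cliques G k X ↔ C ⊆ X ∧ G.IsNClique k C := by
  simp [cliques]

@[simp]
theorem mem_kTreesIn : X ∈ kTreesIn G k W ↔ X ⊆ W ∧ InducesKTree G k X := by
  simp [kTreesIn]

theorem cliques_self (hC : G.IsNClique k C) : cliques G k C = {C} := by
  ext E
  simp only [mem_cliques, Finset.mem_singleton]
  refine ⟨fun ⟨h, hE⟩ => Finset.eq_of_subset_of_card_le h ?_, ?_⟩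
  · rw [hC.card_eq, hE.card_eq]
  · rintro rfl
    exact ⟨subset_rfl, hC⟩

theorem kTreesIn_self (hC : G.IsNClique k C) : kTreesIn G k C = {C} := by
  ext E
  simp only [mem_kTreesIn, Finset.mem_singleton]
  refine ⟨fun ⟨h, hE⟩ => Finset.eq_of_subset_of_card_le h ?_, ?_⟩
  · rw [hC.card_eq]
    exact hE.card_le
  · rintro rfl
    exact ⟨subset_rfl, .of_isNClique hC⟩

/-- `v` is a new vertex outside `W`, joined to the `k`-clique `D` in `W`. -/
structure IsJoin (G : SimpleGraph V) (k : ℕ) (W D : Finset V) (v : V) : Prop where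
  notMem : v ∉ W
  isNClique : G.IsNClique k D
  subset : D ⊆ W
  adj : ∀ w ∈ W, G.Adj v w ↔ w ∈ D

theorem IsJoin.mono (h : IsJoin G k W D v) (hDY : D ⊆ Y) (hYW : Y ⊆ W) : IsJoin G k Y D v :=
  ⟨fun hv => h.notMem (hYW hv), h.isNClique, hDY, fun w hw => h.adj w (hYW hw)⟩

theorem IsJoin.notMem_clique (h : IsJoin G k W D v) : v ∉ D := fun hv => h.notMem (h.subset hv)

theorem IsJoin.isNClique_new (h : IsJoin G k W D v) {u : V} (hu : u ∈ D) :
    G.IsNClique k (insert v (D.erase u)) :=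
  isNClique_insert_erase h.isNClique (fun w hw => (h.adj w (h.subset hw)).2 hw) hu

theorem IsJoin.injOn_new (h : IsJoin G k W D v) :
    Set.InjOn (fun u => insert v (D.erase u)) (D : Set V) := by
  intro x hx y hy hxy
  by_contra hne
  have h1 : x ∈ insert v (D.erase y) := Finset.mem_insert_of_mem (Finset.mem_erase.2 ⟨hne, hx⟩)
  have h2 : x ∉ insert v (D.erase x) := by
    simpa using fun hxv : x = v => h.notMem_clique (hxv ▸ hx)
  exact h2 (hxy.symm.subset h1)

theorem IsJoin.cliques_insert (h : IsJoin G k W D v) (hk : 1 ≤ k) :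
    cliques G k (insert v W) =
      cliques G k W ∪ D.image fun u => insert v (D.erase u) := by
  ext E
  simp only [mem_cliques, Finset.mem_union, Finset.mem_image]
  constructor
  · rintro ⟨hEW, hE⟩
    by_cases hvE : v ∈ E
    · obtain ⟨u, hu, rfl⟩ := exists_eq_insert_erase hk h.isNClique h.adj hE hvE hEW
      exact .inr ⟨u, hu, rfl⟩
    · exact .inl ⟨(Finset.subset_insert_iff_of_notMem hvE).1 hEW, hE⟩
  · rintro (⟨hEW, hE⟩ | ⟨u, hu, rfl⟩)
    · exact ⟨hEW.trans (Finset.subset_insert _ _), hE⟩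
    · exact ⟨Finset.insert_subset_insert _ ((Finset.erase_subset _ _).trans h.subset),
        h.isNClique_new hu⟩

@[to_additive]
theorem IsJoin.prod_cliques_insert {M : Type*} [CommMonoid M] (h : IsJoin G k W D v) (hk : 1 ≤ k)
    (f : Finset V → M) :
    ∏ E ∈ cliques G k (insert v W), f E =
      (∏ E ∈ cliques G k W, f E) * ∏ u ∈ D, f (insert v (D.erase u)) := by
  rw [h.cliques_insert hk, Finset.prod_union, Finset.prod_image h.injOn_new]
  rw [Finset.disjoint_left]
  intro E hE hE'
  obtain ⟨u, -, rfl⟩ := Finset.mem_image.1 hE'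
  exact h.notMem ((mem_cliques.1 hE).1 (Finset.mem_insert_self _ _))

theorem IsJoin.inducesKTree_insert_iff (h : IsJoin G k W D v) (hk : 1 ≤ k) (hYW : Y ⊆ W) :
    InducesKTree G k (insert v Y) ↔
      (InducesKTree G k Y ∧ D ⊆ Y) ∨ ∃ u ∈ D, D.erase u = Y := by
  have hvY : v ∉ Y := fun hv => h.notMem (hYW hv)
  constructor
  · intro hX
    have hadj : ∀ w ∈ insert v Y, G.Adj v w → w ∈ D := fun w hw hvw =>
      (h.adj w (hYW (Finset.mem_of_mem_insert_of_ne hw hvw.ne'))).1 hvw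
    rcases hX.isNClique_or_erase (Finset.mem_insert_self _ _) h.isNClique.card_eq hadj with
      hc | ⟨hDX, -, hX'⟩
    · obtain ⟨u, hu, hYu⟩ := exists_eq_insert_erase hk h.isNClique h.adj hc
        (Finset.mem_insert_self _ _) (Finset.insert_subset_insert _ hYW)
      refine .inr ⟨u, hu, ?_⟩
      have := congrArg (fun Z => Finset.erase Z v) hYu
      simp only [Finset.erase_insert hvY] at this
      rw [this, Finset.erase_insert]
      exact fun hv => h.notMem_clique (Finset.mem_of_mem_erase hv)
    · rw [Finset.erase_insert hvY] at hX'
      exact .inl ⟨hX', (Finset.subset_insert_iff_of_notMem h.notMem_clique).1 hDX⟩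
  · rintro (⟨hY, hDY⟩ | ⟨u, hu, rfl⟩)
    · exact hY.join hvY h.isNClique hDY fun w hw => h.adj w (hYW hw)
    · exact .of_isNClique (h.isNClique_new hu)

/-- A `k`-tree in `W ∪ {v}` is a `k`-tree in `W`, or such a `k`-tree containing `D` together with
`v`, or one of the `k` new cliques through `v`. -/
theorem IsJoin.sum_kTreesIn_insert (h : IsJoin G k W D v) (hk : 1 ≤ k) (φ : Finset V → ℚ) :
    ∑ X ∈ kTreesIn G k (insert v W), φ X =
      ∑ Y ∈ kTreesIn G k W, (φ Y + if D ⊆ Y then φ (insert v Y) else 0) +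
        ∑ u ∈ D, φ (insert v (D.erase u)) := by
  have hsplit : W.powerset.filter (fun Y => InducesKTree G k (insert v Y)) =
      (kTreesIn G k W).filter (D ⊆ ·) ∪ D.image fun u => D.erase u := by
    ext Y
    simp only [Finset.mem_filter, Finset.mem_powerset, Finset.mem_union, mem_kTreesIn,
      Finset.mem_image]
    constructor
    · rintro ⟨hYW, hY⟩
      exact ((h.inducesKTree_insert_iff hk hYW).1 hY).imp (fun hY => ⟨⟨hYW, hY.1⟩, hY.2⟩) id
    · intro hY
      have hYW : Y ⊆ W := by
        rcases hY with hY | ⟨u, -, rfl⟩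
        · exact hY.1.1
        · exact (Finset.erase_subset _ _).trans h.subset
      exact ⟨hYW, (h.inducesKTree_insert_iff hk hYW).2 (hY.imp (fun hY => ⟨hY.1.2, hY.2⟩) id)⟩
  have hdisj : Disjoint ((kTreesIn G k W).filter (D ⊆ ·)) (D.image fun u => D.erase u) := by
    rw [Finset.disjoint_left]
    intro Y hY hY'
    obtain ⟨u, hu, rfl⟩ := Finset.mem_image.1 hY'
    exact Finset.notMem_erase u D ((Finset.mem_filter.1 hY).2 hu)
  have hinj : Set.InjOn (fun u => D.erase u) (D : Set V) := fun x hx y hy hxy => by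
    by_contra hne
    have h1 : x ∈ D.erase y := Finset.mem_erase.2 ⟨hne, hx⟩
    exact Finset.notMem_erase x D (hxy.symm.subset h1)
  rw [kTreesIn, Finset.sum_filter, Finset.sum_powerset_insert h.notMem, ← Finset.sum_filter,
    ← Finset.sum_filter, hsplit, Finset.sum_union hdisj, Finset.sum_image hinj,
    Finset.sum_add_distrib, Finset.sum_filter _ (s := kTreesIn G k W), ← kTreesIn, add_assoc]

/-- The number of ways to extend the `k`-tree on `X` into the `k`-trees hanging at its cliques,
when a rooted `k`-tree with profile `d E` hangs at each clique `E`. -/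
def weight (G : SimpleGraph V) (k : ℕ) (d : Finset V → Profile) (X : Finset V) : ℚ :=
  ∏ E ∈ cliques G k X, (d E).n

/-- The average of (number of vertices) `- k` over the extensions of the `k`-tree on `X` into the
`k`-trees hanging at its cliques. -/
def excess (G : SimpleGraph V) (k : ℕ) (d : Finset V → Profile) (X : Finset V) : ℚ :=
  (X.card : ℚ) - k + ∑ E ∈ cliques G k X, (d E).δ

/-- The profile, with root clique `C`, of the `k`-tree on `W` with a rooted `k`-tree of profile
`d E` hanging at each of its cliques `E`. -/
def total (G : SimpleGraph V) (k : ℕ) (C W : Finset V) (d : Finset V → Profile) : Profile where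
  n := ∑ X ∈ kTreesIn G k W, if C ⊆ X then weight G k d X else 0
  δ := (∑ X ∈ kTreesIn G k W, if C ⊆ X then weight G k d X * excess G k d X else 0) /
    ∑ X ∈ kTreesIn G k W, if C ⊆ X then weight G k d X else 0
  nb := ∑ X ∈ kTreesIn G k W, weight G k d X + ∑ E ∈ cliques G k W, ((d E).nb - (d E).n)
  db := ∑ X ∈ kTreesIn G k W, weight G k d X * excess G k d X +
    ∑ E ∈ cliques G k W, ((d E).db - (d E).n * (d E).δ)

theorem weight_self (hC : G.IsNClique k C) (d : Finset V → Profile) :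
    weight G k d C = (d C).n := by
  simp [weight, cliques_self hC]

theorem excess_self (hC : G.IsNClique k C) (d : Finset V → Profile) :
    excess G k d C = (d C).δ := by
  simp [excess, cliques_self hC, hC.card_eq]

theorem total_self (hC : G.IsNClique k C) (d : Finset V → Profile) (hd : (d C).n ≠ 0) :
    total G k C C d = d C := by
  simp only [total, kTreesIn_self hC, cliques_self hC, Finset.sum_singleton, weight_self hC,
    excess_self hC, subset_rfl, if_true, mul_div_cancel_left₀ _ hd, add_sub_cancel]

/-- The profile hanging at `D` after a vertex `v` joined to `D`, together with everything hanging
at the new cliques through `v`, is counted as part of what hangs at `D`. -/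
def absorb (D : Finset V) (v : V) (d : Finset V → Profile) : Finset V → Profile :=
  Function.update d D (.merge (d D) (.extend D fun u => d (insert v (D.erase u))))

section Absorb

variable {d : Finset V → Profile} {P Δ : ℚ}

theorem absorb_n (hP : ∏ u ∈ D, (d (insert v (D.erase u))).n = P) (E : Finset V) :
    (absorb D v d E).n = (d E).n * if E = D then 1 + P else 1 := by
  rcases eq_or_ne E D with rfl | h
  · simp [absorb, Profile.merge, Profile.extend, hP]
  · simp [absorb, h]

theorem absorb_δ (hP : ∏ u ∈ D, (d (insert v (D.erase u))).n = P)
    (hΔ : ∑ u ∈ D, (d (insert v (D.erase u))).δ = Δ) (E : Finset V) :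
    (absorb D v d E).δ = (d E).δ + if E = D then P * (1 + Δ) / (1 + P) else 0 := by
  rcases eq_or_ne E D with rfl | h
  · simp [absorb, Profile.merge, Profile.extend, hP, hΔ]
  · simp [absorb, h]

theorem absorb_nb_sub (E : Finset V) :
    (absorb D v d E).nb - (absorb D v d E).n =
      ((d E).nb - (d E).n) + if E = D then ∑ u ∈ D, (d (insert v (D.erase u))).nb else 0 := by
  rcases eq_or_ne E D with rfl | h
  · simp only [absorb, Function.update_self, Profile.merge, Profile.extend, if_true]
    ring
  · simp [absorb, h]

theorem absorb_db_sub (hP : 1 + ∏ u ∈ D, (d (insert v (D.erase u))).n ≠ 0) (E : Finset V) :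
    (absorb D v d E).db - (absorb D v d E).n * (absorb D v d E).δ =
      ((d E).db - (d E).n * (d E).δ) +
        if E = D then ∑ u ∈ D, (d (insert v (D.erase u))).db else 0 := by
  rcases eq_or_ne E D with rfl | h
  · simp only [absorb, Function.update_self, Profile.merge, Profile.extend, if_true]
    field_simp
    ring
  · simp [absorb, h]

theorem IsJoin.weight_insert (h : IsJoin G k W D v) (hk : 1 ≤ k) (hDY : D ⊆ Y) (hYW : Y ⊆ W)
    (d : Finset V → Profile) :
    weight G k d (insert v Y) =
      weight G k d Y * ∏ u ∈ D, (d (insert v (D.erase u))).n :=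
  (h.mono hDY hYW).prod_cliques_insert hk _

theorem IsJoin.excess_insert (h : IsJoin G k W D v) (hk : 1 ≤ k) (hDY : D ⊆ Y) (hYW : Y ⊆ W)
    (d : Finset V → Profile) :
    excess G k d (insert v Y) =
      excess G k d Y + (1 + ∑ u ∈ D, (d (insert v (D.erase u))).δ) := by
  rw [excess, (h.mono hDY hYW).sum_cliques_insert hk,
    Finset.card_insert_of_notMem (h.mono hDY hYW).notMem, excess]
  push_cast
  ring

theorem IsJoin.weight_absorb (h : IsJoin G k W D v) (hk : 1 ≤ k) (hYW : Y ⊆ W)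
    (d : Finset V → Profile) :
    weight G k (absorb D v d) Y =
      weight G k d Y + if D ⊆ Y then weight G k d (insert v Y) else 0 := by
  simp only [weight, absorb_n rfl, Finset.prod_mul_distrib, Finset.prod_ite_eq', mem_cliques,
    h.isNClique, and_true]
  split_ifs with hDY
  · have := h.weight_insert hk hDY hYW d
    simp only [weight] at this
    rw [this]
    ring
  · ring

theorem IsJoin.weight_mul_excess_absorb (h : IsJoin G k W D v) (hk : 1 ≤ k) (hYW : Y ⊆ W)
    (d : Finset V → Profile) (hP : 1 + ∏ u ∈ D, (d (insert v (D.erase u))).n ≠ 0) :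
    weight G k (absorb D v d) Y * excess G k (absorb D v d) Y =
      weight G k d Y * excess G k d Y +
        if D ⊆ Y then weight G k d (insert v Y) * excess G k d (insert v Y) else 0 := by
  have he : excess G k (absorb D v d) Y = excess G k d Y +
      if D ⊆ Y then (∏ u ∈ D, (d (insert v (D.erase u))).n) *
        (1 + ∑ u ∈ D, (d (insert v (D.erase u))).δ) /
          (1 + ∏ u ∈ D, (d (insert v (D.erase u))).n) else 0 := by
    simp only [excess, absorb_δ rfl rfl, Finset.sum_add_distrib, Finset.sum_ite_eq', mem_cliques,
      h.isNClique, and_true]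
    ring
  rw [h.weight_absorb hk hYW, he]
  split_ifs with hDY
  · rw [h.weight_insert hk hDY hYW, h.excess_insert hk hDY hYW]
    field_simp
    ring
  · ring

/-- Removing the last vertex of the construction, with the adjusted profile at the clique to which
that vertex is joined, does not change the profile of the whole `k`-tree. -/
theorem IsJoin.total_insert (h : IsJoin G k W D v) (hk : 1 ≤ k) (hC : G.IsNClique k C)
    (hCW : C ⊆ W) (d : Finset V → Profile)
    (hP : 1 + ∏ u ∈ D, (d (insert v (D.erase u))).n ≠ 0) :
    total G k C (insert v W) d = total G k C W (absorb D v d) := by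
  have hvC : v ∉ C := fun hv => h.notMem (hCW hv)
  have rooted : ∀ φ ψ : Finset V → ℚ,
      (∀ Y ⊆ W, ψ Y = φ Y + if D ⊆ Y then φ (insert v Y) else 0) →
      ∑ X ∈ kTreesIn G k (insert v W), (if C ⊆ X then φ X else 0) =
        ∑ Y ∈ kTreesIn G k W, if C ⊆ Y then ψ Y else 0 := by
    intro φ ψ hφ
    rw [h.sum_kTreesIn_insert hk, Finset.sum_eq_zero (s := D), add_zero]
    · refine Finset.sum_congr rfl fun Y hY => ?_
      rw [hφ Y (mem_kTreesIn.1 hY).1]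
      simp only [Finset.subset_insert_iff_of_notMem hvC]
      split_ifs <;> simp
    · intro u hu
      refine if_neg fun hCu => ?_
      have := Finset.card_le_card ((Finset.subset_insert_iff_of_notMem hvC).1 hCu)
      rw [Finset.card_erase_of_mem hu, hC.card_eq, h.isNClique.card_eq] at this
      omega
  have hD : D ∈ cliques G k W := mem_cliques.2 ⟨h.subset, h.isNClique⟩
  have hw := rooted _ _ fun Y hYW => h.weight_absorb hk hYW d
  have he := rooted _ _ fun Y hYW => h.weight_mul_excess_absorb hk hYW d hP
  simp only [total, Profile.mk.injEq]
  refine ⟨hw, by rw [hw, he], ?_, ?_⟩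
  · rw [h.sum_kTreesIn_insert hk, h.sum_cliques_insert hk]
    simp only [absorb_nb_sub, Finset.sum_add_distrib (s := cliques G k W), Finset.sum_ite_eq', hD,
      if_true]
    rw [Finset.sum_congr rfl fun Y hY => h.weight_absorb hk (mem_kTreesIn.1 hY).1 d,
      Finset.sum_congr rfl fun u hu => weight_self (h.isNClique_new hu) d,
      Finset.sum_sub_distrib, Finset.sum_sub_distrib]
    ring
  · rw [h.sum_kTreesIn_insert hk, h.sum_cliques_insert hk]
    simp only [absorb_db_sub hP, Finset.sum_add_distrib (s := cliques G k W), Finset.sum_ite_eq',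
      hD, if_true]
    rw [Finset.sum_congr rfl fun Y hY =>
        h.weight_mul_excess_absorb hk (mem_kTreesIn.1 hY).1 d hP,
      Finset.sum_congr (s₁ := D) (f := fun u => weight G k d _ * excess G k d _) rfl fun u hu => by
        rw [weight_self (h.isNClique_new hu) d, excess_self (h.isNClique_new hu) d],
      Finset.sum_sub_distrib, Finset.sum_sub_distrib]
    ring

theorem BuiltFrom.good_total (hk : 1 ≤ k) (hC : G.IsNClique k C) (h : BuiltFrom G k C W)
    (hd : ∀ E, (d E).Good k) : (total G k C W d).Good k := by
  induction h generalizing d with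
  | base =>
    rw [total_self hC d (by linarith [(hd C).one_le])]
    exact hd C
  | @join W D v hW hv hD hDW hadj ih =>
    have hP : 0 ≤ ∏ u ∈ D, (d (insert v (D.erase u))).n :=
      Finset.prod_nonneg fun u _ => by linarith [(hd (insert v (D.erase u))).one_le]
    rw [IsJoin.total_insert ⟨hv, hD, hDW, hadj⟩ hk hC hW.subset d (by linarith)]
    refine ih fun E => ?_
    rw [absorb, Function.update_apply]
    split_ifs
    · refine (hd D).merge (by exact_mod_cast hk) ?_
      rw [← hD.card_eq]
      exact Profile.Good.extend (hD.card_eq ▸ hk) fun u _ => hD.card_eq ▸ hd _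
    · exact hd E

end Absorb

end Totals

/-! ### The local and the global mean -/

section Means

open Classical

variable {V : Type u} [Fintype V] {k : ℕ} {T : SimpleGraph V} {C W : Finset V}

theorem verts_inducesKTree {X : T.Subgraph} (hX : X ∈ subs k T) :
    InducesKTree X.spanningCoe k X.verts.toFinset :=
  (Finset.mem_filter.1 hX).2.inducesKTree Subtype.val Subtype.val_injective
    (fun _ _ => Iff.rfl) (by simp)

theorem eq_induce_of_mem_subs (hT : IsKTree k T) {X : T.Subgraph} (hX : X ∈ subs k T) :
    X = (⊤ : T.Subgraph).induce X.verts := by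
  have hU : InducesKTree T k Finset.univ :=
    hT.inducesKTree id Function.injective_id (fun _ _ => Iff.rfl) (by simp)
  refine SimpleGraph.Subgraph.ext rfl ?_
  ext a b
  simp only [SimpleGraph.Subgraph.induce_adj, SimpleGraph.Subgraph.top_adj]
  refine ⟨fun h => ⟨h.fst_mem, h.snd_mem, h.adj_sub⟩, fun ⟨ha, hb, hab⟩ => ?_⟩
  exact InducesKTree.adj_of_le X.spanningCoe_le hU (verts_inducesKTree hX)
    (Finset.subset_univ _) (by simpa) (by simpa) hab

theorem toFinset_verts_mem_kTreesIn (hT : IsKTree k T) {X : T.Subgraph} (hX : X ∈ subs k T) :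
    X.verts.toFinset ∈ kTreesIn T k Finset.univ := by
  refine mem_kTreesIn.2 ⟨Finset.subset_univ _, (verts_inducesKTree hX).congr fun a ha b hb => ?_⟩
  rw [SimpleGraph.Subgraph.spanningCoe_adj, eq_induce_of_mem_subs hT hX]
  simp only [Set.mem_toFinset] at ha hb
  simp [ha, hb]

theorem induce_mem_subs (hW : W ∈ kTreesIn T k Finset.univ) :
    (⊤ : T.Subgraph).induce (W : Set V) ∈ subs k T := by
  refine Finset.mem_filter.2 ⟨Finset.mem_univ _, ?_⟩
  refine (mem_kTreesIn.1 hW).2.isKTree Subtype.val Subtype.val_injective (fun a b => ?_) (by simp)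
  have ha := a.2
  have hb := b.2
  simp only [SimpleGraph.Subgraph.induce_verts] at ha hb
  simp [ha, hb]

/-- The sub-`k`-trees of a `k`-tree correspond to the vertex sets that induce `k`-trees. -/
theorem sum_subs (hT : IsKTree k T) (φ : Finset V → ℚ) :
    ∑ X ∈ subs k T, φ X.verts.toFinset = ∑ W ∈ kTreesIn T k Finset.univ, φ W := by
  refine Finset.sum_bij' (fun X _ => X.verts.toFinset)
    (fun W _ => (⊤ : T.Subgraph).induce (W : Set V))
    (fun X hX => toFinset_verts_mem_kTreesIn hT hX) (fun W hW => induce_mem_subs hW)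
    (fun X hX => ?_) (fun W _ => by ext; simp) fun _ _ => rfl
  rw [Set.coe_toFinset]
  exact (eq_induce_of_mem_subs hT hX).symm

theorem sum_subsAt (hT : IsKTree k T) (φ : Finset V → ℚ) :
    ∑ X ∈ subsAt k T C, φ X.verts.toFinset =
      ∑ W ∈ kTreesIn T k Finset.univ, if C ⊆ W then φ W else 0 := by
  rw [subsAt, Finset.sum_filter, ← sum_subs hT fun W => if C ⊆ W then φ W else 0]
  refine Finset.sum_congr rfl fun X hX => if_congr ?_ rfl rfl
  rw [Set.subset_toFinset]
  refine ⟨fun h => h.1, fun h => ?_⟩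
  rw [eq_induce_of_mem_subs hT hX]
  exact SimpleGraph.Subgraph.induce_mono_right h

theorem localMean_lt_two_mul_globalMean (hk : 1 ≤ k) (hT : IsKTree k T) (hC : T.IsNClique k C) :
    localMean k T C < 2 * globalMean k T := by
  obtain ⟨C₀, hC₀, hbuilt⟩ : InducesKTree T k Finset.univ :=
    hT.inducesKTree id Function.injective_id (fun _ _ => Iff.rfl) (by simp)
  have hgood : (total T k C Finset.univ fun _ => .unit).Good k :=
    (hbuilt.reroot hk hC₀ hC (Finset.subset_univ _)).good_total hk hC fun _ => Profile.good_unit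
  -- When nothing hangs at the cliques, the total profile consists of the quantities in the means.
  have hn : (total T k C Finset.univ fun _ => .unit).n = (subsAt k T C).card := by
    have := sum_subsAt (C := C) hT fun _ => 1
    simp only [Finset.sum_const, nsmul_eq_mul, mul_one] at this
    simp [total, weight, Profile.unit, this]
  have hnb : (total T k C Finset.univ fun _ => .unit).nb = (subs k T).card := by
    have := sum_subs hT fun _ => 1
    simp only [Finset.sum_const, nsmul_eq_mul, mul_one] at this
    simp [total, weight, Profile.unit, this]
  have hδ : (total T k C Finset.univ fun _ => .unit).δ =
      (∑ X ∈ subsAt k T C, ((X.verts.ncard : ℚ) - k)) / (subsAt k T C).card := by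
    have h1 := sum_subsAt (C := C) hT fun W => (W.card : ℚ) - k
    rw [← hn]
    simp only [← Set.ncard_eq_toFinset_card'] at h1
    rw [h1]
    simp [total, weight, excess, Profile.unit]
  have hdb : (total T k C Finset.univ fun _ => .unit).db =
      ∑ X ∈ subs k T, ((X.verts.ncard : ℚ) - k) := by
    have h1 := sum_subs hT fun W => (W.card : ℚ) - k
    simp only [← Set.ncard_eq_toFinset_card'] at h1
    rw [h1]
    simp [total, weight, excess, Profile.unit]
  have hone := hgood.one_le
  have hmain := hgood.main
  rw [hn] at hone
  rw [hδ, hnb, hdb] at hmain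
  have hle : ((subsAt k T C).card : ℚ) ≤ (subs k T).card := by
    exact_mod_cast Finset.card_le_card (Finset.filter_subset _ _)
  simp only [Finset.sum_sub_distrib, Finset.sum_const, nsmul_eq_mul] at hmain
  rw [localMean, globalMean, mul_div_assoc', lt_div_iff₀ (by linarith)]
  push_cast
  rw [sub_div, mul_div_cancel_left₀ _ (by linarith)] at hmain
  have hk' : (1 : ℚ) ≤ k := by exact_mod_cast hk
  linarith

end Means

end KTree

theorem mainTheorem2 {V : Type u} [Fintype V] (k : ℕ) (hk : 1 ≤ k) (T : SimpleGraph V)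
    (hT : IsKTree k T) (C : Finset V) (hC : T.IsNClique k C) :
    KTree.localMean k T C < 2 * KTree.globalMean k T :=
  KTree.localMean_lt_two_mul_globalMean hk hT hC
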